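/- Let $n\ge 0$ and let $\alpha=(\alpha_1,\dots,\alpha_\ell)$ be a composition of $n$, that is, a sequence of positive integers with sum $n$. Its diagram has left-justified rows with $\alpha_i$ cells in row $i$ from the top; $(i,k)$ denotes the cell in row $i$ and column $k$. A *standard reverse composition tableau* (SRCT) of shape $\alpha$ is a bijective filling $\tau$ of the diagram by $1,\dots,n$ such that entries decrease from left to right along each row, entries of the first column increase from top to bottom, and, whenever $i<j$ and $\tau(i,k)>\tau(j,k+1)$ (both cells being in the diagram), the cell $(i,k+1)$ is in the diagram and $\tau(i,k+1)>\tau(j,k+1)$. Let $H_n(0)$ be the $\mathbb{C}$-algebra generated by $T_1,\dots,T_{n-1}$ with relations $T_i^2=T_i$, $T_iT_{i+1}T_i=T_{i+1}T_iT_{i+1}$, and $T_iT_j=T_jT_i$ for $|i-j|\ge 2$. Let $\mathbf{S}_\alpha$ be the $H_n(0)$-module whose underlying $\mathbb{C}$-vector space has the SRCTs of shape $\alpha$ as a basis and on which $T_i$ acts by $$T_i\,\tau=\begin{cases}\tau & \text{if } i+1 \text{ lies in a column strictly to the left of that of } i \text{ in } \tau,\\ 0 & \text{if } i \text{ and } i+1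 \text{ are in the same column of } \tau, \text{ or } i+1 \text{ is in the next column to the right of that of } i \text{ and in a strictly lower row},\\ s_i(\tau) & \text{otherwise,}\end{cases}$$ where $s_i(\tau)$ is obtained from $\tau$ by exchanging the entries $i$ and $i+1$. (These operators map into the span of the SRCTs of shape $\alpha$ and satisfy the relations above.) Call $\alpha$ *simple* if, whenever $1\le i<j\le \ell$ and $\alpha_i\ge\alpha_j\ge 2$, there is an integer $k$ with $i<k<j$ and $\alpha_k=\alpha_j-1$. A module is *indecomposable* if it is nonzero and is not the direct sum of two nonzero submodules. **Theorem.** $\mathbf{S}_\alpha$ is an indecomposable $H_n(0)$-module if and only if $\alpha$ is a simple composition. -/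

import Mathlib

/-! ### The 0-Hecke algebra -/

/-- The defining relations of the 0-Hecke algebra. The generator `T_{i+1}` of the usual
indexing is the free generator with index `i : Fin (n - 1)`. -/
inductive ZeroHeckeRel (n : ℕ) :
    FreeAlgebra ℂ (Fin (n - 1)) → FreeAlgebra ℂ (Fin (n - 1)) → Prop
  | idem (i : Fin (n - 1)) :
      ZeroHeckeRel n (FreeAlgebra.ι ℂ i * FreeAlgebra.ι ℂ i) (FreeAlgebra.ι ℂ i)
  | braid (i j : Fin (n - 1)) (h : i.val + 1 = j.val) :
      ZeroHeckeRel n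
        (FreeAlgebra.ι ℂ i * FreeAlgebra.ι ℂ j * FreeAlgebra.ι ℂ i)
        (FreeAlgebra.ι ℂ j * FreeAlgebra.ι ℂ i * FreeAlgebra.ι ℂ j)
  | comm (i j : Fin (n - 1)) (h : i.val + 2 ≤ j.val ∨ j.val + 2 ≤ i.val) :
      ZeroHeckeRel n
        (FreeAlgebra.ι ℂ i * FreeAlgebra.ι ℂ j)
        (FreeAlgebra.ι ℂ j * FreeAlgebra.ι ℂ i)

/-- The 0-Hecke algebra `H_n(0)` over `ℂ`. -/
def ZeroHecke (n : ℕ) : Type := RingQuot (ZeroHeckeRel n)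

noncomputable instance (n : ℕ) : Ring (ZeroHecke n) :=
  inferInstanceAs (Ring (RingQuot (ZeroHeckeRel n)))

noncomputable instance (n : ℕ) : Algebra ℂ (ZeroHecke n) :=
  inferInstanceAs (Algebra ℂ (RingQuot (ZeroHeckeRel n)))

/-- The generators of `H_n(0)`. -/
noncomputable def ZeroHecke.T {n : ℕ} (i : Fin (n - 1)) : ZeroHecke n :=
  RingQuot.mkAlgHom ℂ (ZeroHeckeRel n) (FreeAlgebra.ι ℂ i)

/-! ### Standard reverse composition tableaux -/

/-- The cells of the reverse composition diagram of `α`: row `i` (counted from the top, starting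
at `0`) has `α_i` left-justified cells (columns counted from the left, starting at `0`). -/
abbrev RCCell {n : ℕ} (α : Composition n) : Type :=
  Σ i : Fin α.length, Fin (α.blocksFun i)

/-- The row of a cell, counted from the top, starting at `0`. -/
def RCCell.row {n : ℕ} {α : Composition n} (c : RCCell α) : ℕ := c.1.val

/-- The column of a cell, counted from the left, starting at `0`. -/
def RCCell.col {n : ℕ} {α : Composition n} (c : RCCell α) : ℕ := c.2.val

/-- Standard reverse composition tableaux of shape `α`. The entry `k : Fin n` stands for
the entry `k + 1` of `{1, …, n}`. -/
@[ext]
structure SRCT {n : ℕ} (α : Composition n) where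
  /-- The bijective filling of the cells. -/
  filling : RCCell α ≃ Fin n
  /-- Entries decrease along rows, from left to right. -/
  row_decreasing : ∀ c d : RCCell α, c.row = d.row → c.col < d.col → filling d < filling c
  /-- Entries in the first column increase from top to bottom. -/
  col_increasing : ∀ c d : RCCell α, c.col = 0 → d.col = 0 → c.row < d.row →
    filling c < filling d
  /-- The triple rule. -/
  triple : ∀ c d : RCCell α, c.row < d.row → d.col = c.col + 1 → filling d < filling c →
    ∃ e : RCCell α, e.row = c.row ∧ e.col = d.col ∧ filling d < filling e

/-- The smaller of the two entries exchanged by the `i`-th adjacent transposition. -/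
def entryLo {n : ℕ} (i : Fin (n - 1)) : Fin n := ⟨i.val, by omega⟩

/-- The larger of the two entries exchanged by the `i`-th adjacent transposition. -/
def entryHi {n : ℕ} (i : Fin (n - 1)) : Fin n := ⟨i.val + 1, by omega⟩

namespace SRCT

variable {n : ℕ} {α : Composition n}

/-- The row containing the entry `k`. -/
def rowOf (τ : SRCT α) (k : Fin n) : ℕ := (τ.filling.symm k).row

/-- The column containing the entry `k`. -/
def colOf (τ : SRCT α) (k : Fin n) : ℕ := (τ.filling.symm k).col

/-- `i` is a descent of `τ`: the entry `i + 1` is weakly to the right of the entry `i`. -/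
def IsDescent (τ : SRCT α) (i : Fin (n - 1)) : Prop :=
  τ.colOf (entryLo i) ≤ τ.colOf (entryHi i)

/-- `i` and `i + 1` are attacking in `τ`: they are in the same column, or in adjacent columns with
`i + 1` strictly southeast of `i`. -/
def IsAttacking (τ : SRCT α) (i : Fin (n - 1)) : Prop :=
  τ.colOf (entryLo i) = τ.colOf (entryHi i) ∨
    (τ.colOf (entryHi i) = τ.colOf (entryLo i) + 1 ∧
      τ.rowOf (entryLo i) < τ.rowOf (entryHi i))

theorem cell_ext {c d : RCCell α} (h : c.row = d.row) (h' : c.col = d.col) : c = d := by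
  rcases c with ⟨i, a⟩
  rcases d with ⟨j, b⟩
  have hij : i = j := Fin.ext h
  subst hij
  have hab : a = b := Fin.ext h'
  rw [hab]

theorem entryLo_lt (i : Fin (n - 1)) : entryLo i < entryHi i := by
  simp [entryLo, entryHi, Fin.lt_def]

theorem swap_lt_swap {i : Fin (n - 1)} {x y : Fin n}
    (h : ¬ (x = entryLo i ∧ y = entryHi i)) (hxy : x < y) :
    Equiv.swap (entryLo i) (entryHi i) x < Equiv.swap (entryLo i) (entryHi i) y := by
  simp only [Equiv.swap_apply_def]
  simp only [entryLo, entryHi, Fin.lt_def, Fin.ext_iff] at *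
  split_ifs <;> (try dsimp only) <;> omega

theorem lt_of_swap_lt_swap {i : Fin (n - 1)} {x y : Fin n}
    (h : ¬ (x = entryHi i ∧ y = entryLo i))
    (hxy : Equiv.swap (entryLo i) (entryHi i) x < Equiv.swap (entryLo i) (entryHi i) y) :
    x < y := by
  have := swap_lt_swap (i := i) (x := Equiv.swap (entryLo i) (entryHi i) x)
    (y := Equiv.swap (entryLo i) (entryHi i) y) ?_ hxy
  · simpa using this
  · rintro ⟨h1, h2⟩
    apply h
    constructor
    · have := congrArg (Equiv.swap (entryLo i) (entryHi i)) h1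
      simpa using this
    · have := congrArg (Equiv.swap (entryLo i) (entryHi i)) h2
      simpa using this

/-- The tableau `s_i(τ)` obtained by exchanging the entries `i` and `i + 1`, for a non-attacking
descent `i`. -/
def exchange (τ : SRCT α) (i : Fin (n - 1)) (hd : τ.IsDescent i) (ha : ¬ τ.IsAttacking i) :
    SRCT α where
  filling := τ.filling.trans (Equiv.swap (entryLo i) (entryHi i))
  row_decreasing c d hr hc := by
    have h := τ.row_decreasing c d hr hc
    refine swap_lt_swap ?_ h
    rintro ⟨h1, h2⟩
    unfold IsDescent colOf at hd
    rw [← h1, ← h2] at hd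
    simp only [Equiv.symm_apply_apply] at hd
    omega
  col_increasing c d hc hd' hr := by
    have h := τ.col_increasing c d hc hd' hr
    refine swap_lt_swap ?_ h
    rintro ⟨h1, h2⟩
    apply ha
    left
    unfold colOf
    rw [← h1, ← h2]
    simp only [Equiv.symm_apply_apply]
    omega
  triple c d hr hc hlt := by
    have h : τ.filling d < τ.filling c := by
      refine lt_of_swap_lt_swap ?_ hlt
      rintro ⟨h1, h2⟩
      apply ha
      right
      unfold colOf rowOf
      rw [← h1, ← h2]
      simp only [Equiv.symm_apply_apply]
      exact ⟨hc, hr⟩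
    obtain ⟨e, he, he', hlt'⟩ := τ.triple c d hr hc h
    refine ⟨e, he, he', swap_lt_swap ?_ hlt'⟩
    rintro ⟨h1, h2⟩
    apply ha
    left
    unfold colOf
    rw [← h1, ← h2]
    simp only [Equiv.symm_apply_apply]
    omega

open Classical in
/-- The value of the operator `π_i` on the basis vector indexed by the tableau `τ`. -/
noncomputable def piOn (i : Fin (n - 1)) (τ : SRCT α) : SRCT α →₀ ℂ :=
  if hd : τ.IsDescent i then
    if ha : τ.IsAttacking i then 0 else Finsupp.single (τ.exchange i hd ha) 1
  else Finsupp.single τ 1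

/-- The operator `π_i` on the `ℂ`-vector space with basis the tableaux of shape `α`. -/
noncomputable def piOp (α : Composition n) (i : Fin (n - 1)) :
    Module.End ℂ (SRCT α →₀ ℂ) :=
  Finsupp.linearCombination ℂ (piOn i)

/-- The three possible values of `π_i` on a tableau. -/
theorem piOp_cases (τ : SRCT α) (i : Fin (n - 1)) :
    (¬ τ.IsDescent i ∧ piOp α i (Finsupp.single τ 1) = Finsupp.single τ 1) ∨
    (τ.IsDescent i ∧ τ.IsAttacking i ∧ piOp α i (Finsupp.single τ 1) = 0) ∨
    (τ.IsDescent i ∧ ¬ τ.IsAttacking i ∧ ∃ τ' : SRCT α,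
      piOp α i (Finsupp.single τ 1) = Finsupp.single τ' 1 ∧
      (∀ k, τ'.filling k = Equiv.swap (entryLo i) (entryHi i) (τ.filling k)) ∧
      (∀ k, τ'.colOf k = τ.colOf (Equiv.swap (entryLo i) (entryHi i) k)) ∧
      (∀ k, τ'.rowOf k = τ.rowOf (Equiv.swap (entryLo i) (entryHi i) k))) := by
  have key : piOp α i (Finsupp.single τ 1) = piOn i τ := by
    simp [piOp, Finsupp.linearCombination_single]
  rw [key]
  unfold piOn
  by_cases hd : τ.IsDescent i
  · by_cases ha : τ.IsAttacking i
    · simp [hd, ha]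
    · right; right
      refine ⟨hd, ha, τ.exchange i hd ha, by simp [hd, ha], ?_, ?_, ?_⟩ <;>
        intro k <;> simp [exchange, colOf, rowOf]
  · simp [hd]

theorem same_cell (τ : SRCT α) {a b : Fin n} (h : τ.colOf a = τ.colOf b)
    (h' : τ.rowOf a = τ.rowOf b) : a = b :=
  τ.filling.symm.injective (cell_ext h' h)

/-- Consecutive entries in one column increase downwards in the first column only. -/
theorem same_column (τ : SRCT α) (i : Fin (n - 1))
    (h : τ.colOf (entryLo i) = τ.colOf (entryHi i)) :
    (τ.colOf (entryLo i) = 0 ∧ τ.rowOf (entryLo i) < τ.rowOf (entryHi i)) ∨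
    (0 < τ.colOf (entryLo i) ∧ τ.rowOf (entryHi i) < τ.rowOf (entryLo i)) := by
  have hlt := entryLo_lt i
  have hne : τ.rowOf (entryLo i) ≠ τ.rowOf (entryHi i) := fun h' =>
    hlt.ne (τ.same_cell h h')
  set c := τ.filling.symm (entryLo i) with hc
  set d := τ.filling.symm (entryHi i) with hd
  have ec : τ.filling c = entryLo i := by simp [hc]
  have ed : τ.filling d = entryHi i := by simp [hd]
  have h1 : c.col = d.col := h
  have h2 : c.row ≠ d.row := hne
  change (c.col = 0 ∧ c.row < d.row) ∨ (0 < c.col ∧ d.row < c.row)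
  by_cases h0 : c.col = 0
  · left
    refine ⟨h0, ?_⟩
    by_contra hcon
    have := τ.col_increasing d c (by omega) h0 (by omega)
    rw [ec, ed] at this
    exact absurd this (not_lt.2 hlt.le)
  · right
    refine ⟨by omega, ?_⟩
    by_contra hcon
    let x : RCCell α := ⟨c.1, ⟨c.2.val - 1, by omega⟩⟩
    have xr : x.row = c.row := rfl
    have xc : x.col = c.col - 1 := rfl
    have hx := τ.row_decreasing x c xr (by omega)
    have hxd : x ≠ d := by
      intro hxd
      rw [hxd] at xr
      omega
    have hxd' : τ.filling d < τ.filling x := by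
      have hn : τ.filling x ≠ τ.filling d := fun hh => hxd (τ.filling.injective hh)
      rw [ec] at hx
      rw [ed] at hn ⊢
      simp only [entryLo, entryHi, Fin.lt_def, ne_eq, Fin.ext_iff] at *
      omega
    obtain ⟨e, he, he', hlt'⟩ := τ.triple x d (by omega) (by omega) hxd'
    have : e = c := cell_ext (by omega) (by omega)
    rw [this, ec, ed] at hlt'
    exact absurd hlt' (not_lt.2 hlt.le)

/-- A non-attacking descent whose entries are in adjacent columns has its larger entry strictly
higher, and neither of them is in the first column. -/
theorem adjacent_nonattacking (τ : SRCT α) (i : Fin (n - 1)) (ha : ¬ τ.IsAttacking i)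
    (h : τ.colOf (entryHi i) = τ.colOf (entryLo i) + 1) :
    0 < τ.colOf (entryLo i) ∧ τ.rowOf (entryHi i) < τ.rowOf (entryLo i) := by
  have hlt := entryLo_lt i
  unfold IsAttacking at ha
  set c := τ.filling.symm (entryLo i) with hc
  set d := τ.filling.symm (entryHi i) with hd
  have ec : τ.filling c = entryLo i := by simp [hc]
  have ed : τ.filling d = entryHi i := by simp [hd]
  have h1 : d.col = c.col + 1 := h
  change ¬ (c.col = d.col ∨ (d.col = c.col + 1 ∧ c.row < d.row)) at ha
  change 0 < c.col ∧ d.row < c.row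
  have hne : c.row ≠ d.row := by
    intro hr
    have := τ.row_decreasing c d hr (by omega)
    rw [ec, ed] at this
    exact absurd this (not_lt.2 hlt.le)
  refine ⟨?_, by omega⟩
  by_contra h0
  let x : RCCell α := ⟨d.1, ⟨d.2.val - 1, by omega⟩⟩
  have xr : x.row = d.row := rfl
  have xc : x.col = d.col - 1 := rfl
  have hx := τ.row_decreasing x d xr (by omega)
  have := τ.col_increasing x c (by omega) (by omega) (by omega)
  rw [ec] at this
  rw [ed] at hx
  exact absurd (hx.trans this) (not_lt.2 hlt.le)


theorem piOp_idem (i : Fin (n - 1)) : piOp α i * piOp α i = piOp α i := by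
  refine Finsupp.lhom_ext' fun τ => LinearMap.ext_ring ?_
  simp only [LinearMap.comp_apply, Finsupp.lsingle_apply, Module.End.mul_apply]
  rcases τ.piOp_cases i with ⟨-, h⟩ | ⟨-, -, h⟩ | ⟨hd, ha, τ', h, -, hc, -⟩
  · rw [h, h]
  · rw [h, map_zero]
  · rw [h]
    rcases τ'.piOp_cases i with ⟨-, h'⟩ | ⟨hd', -⟩ | ⟨hd', -⟩
    · rw [h']
    all_goals
      exfalso
      simp only [IsDescent, IsAttacking, hc, Equiv.swap_apply_left, Equiv.swap_apply_right]
        at hd hd' ha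
      omega

theorem piOp_comm (i j : Fin (n - 1)) (hij : i.val + 2 ≤ j.val ∨ j.val + 2 ≤ i.val) :
    piOp α i * piOp α j = piOp α j * piOp α i := by
  have e1 : entryLo i ≠ entryLo j := by simp only [entryLo, ne_eq, Fin.ext_iff]; omega
  have e2 : entryLo i ≠ entryHi j := by simp only [entryLo, entryHi, ne_eq, Fin.ext_iff]; omega
  have e3 : entryHi i ≠ entryLo j := by simp only [entryLo, entryHi, ne_eq, Fin.ext_iff]; omega
  have e4 : entryHi i ≠ entryHi j := by simp only [entryHi, ne_eq, Fin.ext_iff]; omega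
  have hs : ∀ x, Equiv.swap (entryLo i) (entryHi i) (Equiv.swap (entryLo j) (entryHi j) x) =
      Equiv.swap (entryLo j) (entryHi j) (Equiv.swap (entryLo i) (entryHi i) x) := by
    intro x
    simp only [Equiv.swap_apply_def]
    grind
  refine Finsupp.lhom_ext' fun τ => LinearMap.ext_ring ?_
  simp only [LinearMap.comp_apply, Finsupp.lsingle_apply, Module.End.mul_apply]
  have si1 := Equiv.swap_apply_of_ne_of_ne e1.symm e3.symm
  have si2 := Equiv.swap_apply_of_ne_of_ne e2.symm e4.symm
  have sj1 := Equiv.swap_apply_of_ne_of_ne e1 e2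
  have sj2 := Equiv.swap_apply_of_ne_of_ne e3 e4
  rcases τ.piOp_cases i with ⟨hi, h⟩ | ⟨hi, hai, h⟩ | ⟨hi, hai, τ₁, h, hf, hc, hr⟩ <;>
  rcases τ.piOp_cases j with ⟨hj, h'⟩ | ⟨hj, haj, h'⟩ | ⟨hj, haj, τ₂, h', hf', hc', hr'⟩
  · rw [h, h', h]
  · rw [h, h', map_zero]
  · rw [h, h']
    rcases τ₂.piOp_cases i with ⟨g, k⟩ | ⟨g, -, k⟩ | ⟨g, -⟩
    · rw [k]
    all_goals simp only [IsDescent, hc', sj1, sj2] at g hi; omega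
  · rw [h, h', map_zero, h]
  · rw [h, h', map_zero, map_zero]
  · rw [h, h', map_zero]
    rcases τ₂.piOp_cases i with ⟨g, k⟩ | ⟨g, -, k⟩ | ⟨g, g', k⟩
    · simp only [IsDescent, hc', sj1, sj2] at g hi; omega
    · rw [k]
    · simp only [IsAttacking, hc', hr', sj1, sj2] at g' hai; omega
  · rw [h, h']
    rcases τ₁.piOp_cases j with ⟨g, k⟩ | ⟨g, -, k⟩ | ⟨g, -⟩
    · rw [k, h]
    all_goals simp only [IsDescent, hc, si1, si2] at g hj; omega
  · rw [h, h', map_zero]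
    rcases τ₁.piOp_cases j with ⟨g, k⟩ | ⟨g, -, k⟩ | ⟨g, g', k⟩
    · simp only [IsDescent, hc, si1, si2] at g hj; omega
    · rw [k]
    · simp only [IsAttacking, hc, hr, si1, si2] at g' haj; omega
  · rw [h, h']
    rcases τ₁.piOp_cases j with ⟨g, k⟩ | ⟨g, g', k⟩ | ⟨g, g', τ₃, k, hf₃, -⟩
    · simp only [IsDescent, hc, si1, si2] at g hj; omega
    · simp only [IsAttacking, hc, hr, si1, si2] at g' haj; omega
    rcases τ₂.piOp_cases i with ⟨q, k'⟩ | ⟨q, q', k'⟩ | ⟨q, q', τ₄, k', hf₄, -⟩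
    · simp only [IsDescent, hc', sj1, sj2] at q hi; omega
    · simp only [IsAttacking, hc', hr', sj1, sj2] at q' hai; omega
    rw [k, k']
    congr 1
    refine SRCT.ext (Equiv.ext fun x => ?_)
    rw [hf₃, hf₄, hf, hf', hs]

theorem piOp_braid (i j : Fin (n - 1)) (hij : i.val + 1 = j.val) :
    piOp α i * piOp α j * piOp α i = piOp α j * piOp α i * piOp α j := by
  obtain ⟨a, ha⟩ : ∃ a, a = entryLo i := ⟨_, rfl⟩
  obtain ⟨b, hb⟩ : ∃ b, b = entryHi i := ⟨_, rfl⟩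
  obtain ⟨c, hc⟩ : ∃ c, c = entryHi j := ⟨_, rfl⟩
  have hb' : entryLo j = b := by
    rw [hb]; simp only [entryLo, entryHi, Fin.ext_iff]; omega
  have hab : a ≠ b := by
    rw [ha, hb]; simp only [entryLo, entryHi, ne_eq, Fin.ext_iff]; omega
  have hbc : b ≠ c := by
    rw [hb, hc]; simp only [entryHi, ne_eq, Fin.ext_iff]; omega
  have hac : a ≠ c := by
    rw [ha, hc]; simp only [entryLo, entryHi, ne_eq, Fin.ext_iff]; omega
  have step_i := fun τ : SRCT α => τ.piOp_cases i
  have step_j := fun τ : SRCT α => τ.piOp_cases j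
  have sc_i := fun τ : SRCT α => τ.same_column i
  have sc_j := fun τ : SRCT α => τ.same_column j
  have adj_i := fun τ : SRCT α => τ.adjacent_nonattacking i
  have adj_j := fun τ : SRCT α => τ.adjacent_nonattacking j
  simp only [IsDescent, IsAttacking, ← ha, ← hb, ← hc, hb'] at step_i step_j sc_i sc_j adj_i adj_j
  have s1 : Equiv.swap a b a = b := by simp
  have s2 : Equiv.swap a b b = a := by simp
  have s3 : Equiv.swap a b c = c := Equiv.swap_apply_of_ne_of_ne hac.symm hbc.symm
  have t1 : Equiv.swap b c a = a := Equiv.swap_apply_of_ne_of_ne hab hac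
  have t2 : Equiv.swap b c b = c := by simp
  have t3 : Equiv.swap b c c = b := by simp
  have hs : ∀ x, Equiv.swap a b (Equiv.swap b c (Equiv.swap a b x)) =
      Equiv.swap b c (Equiv.swap a b (Equiv.swap b c x)) := by
    intro x
    simp only [Equiv.swap_apply_def]
    grind
  refine Finsupp.lhom_ext' fun τ => LinearMap.ext_ring ?_
  simp only [LinearMap.comp_apply, Finsupp.lsingle_apply, Module.End.mul_apply]
  have hi : ∀ τ : SRCT α,
      (¬ τ.colOf a ≤ τ.colOf b ∧ piOp α i (Finsupp.single τ 1) = Finsupp.single τ 1) ∨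
      (τ.colOf a ≤ τ.colOf b ∧ (τ.colOf a = τ.colOf b ∨
        (τ.colOf b = τ.colOf a + 1 ∧ τ.rowOf a < τ.rowOf b)) ∧
        piOp α i (Finsupp.single τ 1) = 0) ∨
      (τ.colOf a < τ.colOf b ∧ ¬ (τ.colOf b = τ.colOf a + 1 ∧ τ.rowOf a < τ.rowOf b) ∧
        ∃ τ' : SRCT α, piOp α i (Finsupp.single τ 1) = Finsupp.single τ' 1 ∧
        (∀ k, τ'.filling k = Equiv.swap a b (τ.filling k)) ∧
        (τ'.colOf a = τ.colOf b ∧ τ'.colOf b = τ.colOf a ∧ τ'.colOf c = τ.colOf c ∧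
        τ'.rowOf a = τ.rowOf b ∧ τ'.rowOf b = τ.rowOf a ∧ τ'.rowOf c = τ.rowOf c)) := by
    intro τ
    rcases step_i τ with ⟨d, h⟩ | ⟨d, g, h⟩ | ⟨d, g, τ', h, f, q, r⟩
    · exact Or.inl ⟨d, h⟩
    · exact Or.inr (Or.inl ⟨d, g, h⟩)
    · refine Or.inr (Or.inr ⟨by omega, by omega, τ', h, f, ?_⟩)
      simp only [q, r, s1, s2, s3, and_self]
  have hj : ∀ τ : SRCT α,
      (¬ τ.colOf b ≤ τ.colOf c ∧ piOp α j (Finsupp.single τ 1) = Finsupp.single τ 1) ∨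
      (τ.colOf b ≤ τ.colOf c ∧ (τ.colOf b = τ.colOf c ∨
        (τ.colOf c = τ.colOf b + 1 ∧ τ.rowOf b < τ.rowOf c)) ∧
        piOp α j (Finsupp.single τ 1) = 0) ∨
      (τ.colOf b < τ.colOf c ∧ ¬ (τ.colOf c = τ.colOf b + 1 ∧ τ.rowOf b < τ.rowOf c) ∧
        ∃ τ' : SRCT α, piOp α j (Finsupp.single τ 1) = Finsupp.single τ' 1 ∧
        (∀ k, τ'.filling k = Equiv.swap b c (τ.filling k)) ∧
        (τ'.colOf a = τ.colOf a ∧ τ'.colOf b = τ.colOf c ∧ τ'.colOf c = τ.colOf b ∧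
        τ'.rowOf a = τ.rowOf a ∧ τ'.rowOf b = τ.rowOf c ∧ τ'.rowOf c = τ.rowOf b)) := by
    intro τ
    rcases step_j τ with ⟨d, h⟩ | ⟨d, g, h⟩ | ⟨d, g, τ', h, f, q, r⟩
    · exact Or.inl ⟨d, h⟩
    · exact Or.inr (Or.inl ⟨d, g, h⟩)
    · refine Or.inr (Or.inr ⟨by omega, by omega, τ', h, f, ?_⟩)
      simp only [q, r, t1, t2, t3, and_self]
  have idem_i : ∀ v, piOp α i (piOp α i v) = piOp α i v := fun v =>
    LinearMap.congr_fun (piOp_idem i) v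
  have idem_j : ∀ v, piOp α j (piOp α j v) = piOp α j v := fun v =>
    LinearMap.congr_fun (piOp_idem j) v
  have u1 := sc_i τ
  have u2 := sc_j τ
  have u3 := adj_i τ
  have u4 := adj_j τ
  clear step_i step_j adj_i adj_j sc_i sc_j s1 s2 s3 t1 t2 t3
  rcases hi τ with ⟨d1, h1⟩ | ⟨d1, a1, h1⟩ | ⟨d1, a1, τ₁, h1, f1, c1⟩ <;>
  rcases hj τ with ⟨d2, h2⟩ | ⟨d2, a2, h2⟩ | ⟨d2, a2, τ₂, h2, f2, c2⟩
  · rw [h1, h2, h1, h2]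
  · rw [h1, h2, map_zero, map_zero]
  · rw [h1, h2]
    rcases hi τ₂ with ⟨d3, h3⟩ | ⟨d3, a3, h3⟩ | ⟨d3, a3, τ₃, h3, f3, c3⟩
    · rw [h3, ← h2, idem_j]
    · rw [h3, map_zero]
    · rw [h3]
      rcases hj τ₃ with ⟨d4, h4⟩ | ⟨d4, -⟩ | ⟨d4, -⟩
      · rw [h4]
      all_goals omega
  · rw [h1, h2, map_zero, map_zero, h1, map_zero]
  · rw [h1, h2, map_zero, map_zero, map_zero]
  · rw [h1, h2, map_zero, map_zero]
    rcases hi τ₂ with ⟨d3, -⟩ | ⟨d3, a3, h3⟩ | ⟨d3, a3, τ₃, h3, f3, c3⟩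
    · omega
    · rw [h3, map_zero]
    · rw [h3]
      rcases hj τ₃ with ⟨d4, h4⟩ | ⟨d4, a4, h4⟩ | ⟨d4, a4, -⟩
      · omega
      · rw [h4]
      · omega
  · rw [h2, h1]
    rcases hj τ₁ with ⟨d3, h3⟩ | ⟨d3, a3, h3⟩ | ⟨d3, a3, τ₃, h3, f3, c3⟩
    · rw [h3, ← h1, idem_i]
    · rw [h3, map_zero]
    · rw [h3]
      rcases hi τ₃ with ⟨d4, h4⟩ | ⟨d4, -⟩ | ⟨d4, -⟩
      · rw [h4]
      all_goals omega
  · rw [h1, h2, map_zero, map_zero]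
    rcases hj τ₁ with ⟨d3, -⟩ | ⟨d3, a3, h3⟩ | ⟨d3, a3, τ₃, h3, f3, c3⟩
    · omega
    · rw [h3, map_zero]
    · rw [h3]
      rcases hi τ₃ with ⟨d4, h4⟩ | ⟨d4, a4, h4⟩ | ⟨d4, a4, -⟩
      · omega
      · rw [h4]
      · omega
  · rw [h1, h2]
    rcases hj τ₁ with ⟨d3, -⟩ | ⟨d3, a3, h3⟩ | ⟨d3, a3, τ₃, h3, f3, c3⟩
    · omega
    · omega
    rcases hi τ₂ with ⟨d4, -⟩ | ⟨d4, a4, h4⟩ | ⟨d4, a4, τ₄, h4, f4, c4⟩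
    · omega
    · omega
    rw [h3, h4]
    rcases hi τ₃ with ⟨d5, -⟩ | ⟨d5, a5, h5⟩ | ⟨d5, a5, τ₅, h5, f5, c5⟩
    · omega
    · omega
    rcases hj τ₄ with ⟨d6, -⟩ | ⟨d6, a6, h6⟩ | ⟨d6, a6, τ₆, h6, f6, c6⟩
    · omega
    · omega
    rw [h5, h6]
    congr 1
    refine SRCT.ext (Equiv.ext fun x => ?_)
    rw [f5, f3, f1, f6, f4, f2, hs]

end SRCT

/-! ### The module `S_α` -/

/-- The action of `H_n(0)` on the `ℂ`-vector space with basis the standard reverse composition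
tableaux of shape `α`, in which the generator `T_i` acts as `π_i`. -/
noncomputable def zeroHeckeAction {n : ℕ} (α : Composition n) :
    ZeroHecke n →ₐ[ℂ] Module.End ℂ (SRCT α →₀ ℂ) :=
  RingQuot.liftAlgHom ℂ ⟨FreeAlgebra.lift ℂ (SRCT.piOp α), by
    intro x y h
    cases h with
    | idem i =>
      simp only [map_mul, FreeAlgebra.lift_ι_apply]
      exact SRCT.piOp_idem i
    | braid i j hij =>
      simp only [map_mul, FreeAlgebra.lift_ι_apply]
      exact SRCT.piOp_braid i j hij
    | comm i j hij =>
      simp only [map_mul, FreeAlgebra.lift_ι_apply]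
      exact SRCT.piOp_comm i j hij⟩

theorem zeroHeckeAction_T {n : ℕ} (α : Composition n) (i : Fin (n - 1)) :
    zeroHeckeAction α (ZeroHecke.T i) = SRCT.piOp α i :=
  (RingQuot.liftAlgHom_mkAlgHom_apply ℂ _ _ _).trans (FreeAlgebra.lift_ι_apply _ _)

/-- The module `S_α`: the `ℂ`-vector space with basis the standard reverse composition tableaux
of shape `α`, with `H_n(0)` acting through `zeroHeckeAction α`. -/
def SModule {n : ℕ} (α : Composition n) : Type := SRCT α →₀ ℂ

noncomputable instance {n : ℕ} (α : Composition n) : AddCommGroup (SModule α) :=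
  inferInstanceAs (AddCommGroup (SRCT α →₀ ℂ))

noncomputable instance {n : ℕ} (α : Composition n) : Module ℂ (SModule α) :=
  inferInstanceAs (Module ℂ (SRCT α →₀ ℂ))

noncomputable instance {n : ℕ} (α : Composition n) : Module (ZeroHecke n) (SModule α) :=
  Module.compHom (SRCT α →₀ ℂ) (zeroHeckeAction α).toRingHom

theorem zeroHecke_smul_def {n : ℕ} (α : Composition n) (h : ZeroHecke n) (v : SModule α) :
    h • v = zeroHeckeAction α h v := rfl

/-! ### Indecomposable modules and simple compositions -/

/-- A module is indecomposable if it is nonzero and is not the direct sum of two nonzero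
submodules. -/
def IsIndecomposableModule (R M : Type*) [Ring R] [AddCommGroup M] [Module R M] : Prop :=
  Nontrivial M ∧ ∀ N P : Submodule R M, IsCompl N P → N = ⊥ ∨ P = ⊥

/-- A composition `α` is simple if, whenever `α_i ≥ α_j ≥ 2` with `i < j`, there is `k` with
`i < k < j` and `α_k = α_j - 1`. -/
def Composition.IsSimpleComposition {n : ℕ} (α : Composition n) : Prop :=
  ∀ i j : Fin α.length, i < j → α.blocksFun j ≤ α.blocksFun i → 2 ≤ α.blocksFun j →
    ∃ k : Fin α.length, i < k ∧ k < j ∧ α.blocksFun k = α.blocksFun j - 1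

/-!
The operators `π_i` never exchange two entries of one column. Hence the tableaux in which all
columns increase from top to bottom, and the remaining ones, span two complementary submodules of
`S_α`. The first is nonzero, as it contains the row-ordered tableau `σ` (the rows filled one after
the other, each from right to left, see `SRCT.IsRowOrdered`). The second is zero exactly if `α` is
simple: for simple `α` the triple rule excludes inversions in columns
(`SRCT.columnsIncrease_of_isSimpleComposition`), and for other `α` moving a single cell in the
filling order of `σ` creates one (`SRCT.exists_not_columnsIncrease`). So `S_α` decomposes if `α`
is not simple.

Let all tableaux have increasing columns. Then `σ` generates `S_α`
(`SRCT.single_mem_of_isRowOrdered`): any other tableau is the image under some `π_i` of a tableau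
with greater `∑ k, k * colOf k`. On the other hand, the vectors fixed by all the `π_i` fixing `σ`
are the multiples of `σ` (`SRCT.eq_smul_single_of_piOp_eq`): only tableaux whose descents are
descents of `σ` occur in such a vector, and comparing the sums of the columns of all entries shows
that `σ` is the only one (`SRCT.ColumnsIncrease.eq_of_isDescent`). If `S_α = N ⊕ P`, both
components of `σ` are such vectors, so `N` or `P` contains `σ` and is everything.
-/

namespace SRCT

variable {n : ℕ} {α : Composition n}

/-! ### Cells and fillings -/

theorem exists_cell_left (c : RCCell α) {k : ℕ} (hk : k ≤ c.col) :
    ∃ e : RCCell α, e.row = c.row ∧ e.col = k :=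
  ⟨⟨c.1, ⟨k, lt_of_le_of_lt hk c.2.isLt⟩⟩, rfl, rfl⟩

instance : Finite (SRCT α) :=
  Finite.of_injective SRCT.filling fun _ _ h => SRCT.ext h

/-- Any injective key on the cells, with values in a linear order, is realised up to order by a
bijective filling with `0, …, n - 1`. -/
theorem exists_filling_of_key {L : Type*} [LinearOrder L] (key : RCCell α → L)
    (hkey : Function.Injective key) :
    ∃ f : RCCell α ≃ Fin n, ∀ c d, f c < f d ↔ key c < key d := by
  classical
  have hcard : Fintype.card (Set.range key) = n := by
    rw [Set.card_range_of_injective hkey]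
    simp
  let o := Fintype.orderIsoFinOfCardEq (Set.range key) hcard
  refine ⟨(Equiv.ofInjective key hkey).trans o.symm.toEquiv, fun c d => ?_⟩
  simp [← Subtype.coe_lt_coe]

/-- Entries increase from top to bottom in every column. -/
def ColumnsIncrease (τ : SRCT α) : Prop :=
  ∀ c d : RCCell α, c.col = d.col → c.row < d.row → τ.filling c < τ.filling d

/-- Every entry of a row is smaller than every entry of any lower row. There is exactly one such
tableau, obtained by filling the rows one after the other, each from right to left. -/
def IsRowOrdered (τ : SRCT α) : Prop :=
  ∀ c d : RCCell α, c.row < d.row → τ.filling c < τ.filling d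

theorem IsRowOrdered.columnsIncrease {τ : SRCT α} (h : τ.IsRowOrdered) : τ.ColumnsIncrease :=
  fun c d _ => h c d

theorem exists_isRowOrdered (α : Composition n) : ∃ τ : SRCT α, τ.IsRowOrdered := by
  obtain ⟨f, hf⟩ := exists_filling_of_key
    (fun c : RCCell α => toLex ((c.row : ℤ), -(c.col : ℤ))) (by
      intro c d h
      simp only [EmbeddingLike.apply_eq_iff_eq, Prod.mk.injEq] at h
      exact cell_ext (by omega) (by omega))
  simp only [Prod.Lex.toLex_lt_toLex] at hf
  refine ⟨⟨f, ?_, ?_, ?_⟩, ?_⟩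
  · intro c d hr hc
    rw [hf]; omega
  · intro c d hc hd hr
    rw [hf]; omega
  · intro c d hr hc hlt
    rw [hf] at hlt; omega
  · intro c d hr
    change f c < f d
    rw [hf]; omega

/-! ### Simple compositions and increasing columns -/

/-- An inversion between two rows in one column persists in all further columns of the lower row:
this is the triple rule, applied repeatedly. -/
theorem inversion_right (τ : SRCT α) {c d : RCCell α} (hcol : c.col = d.col)
    (hrow : c.row < d.row) (hlt : τ.filling d < τ.filling c) (e : RCCell α)
    (her : e.row = d.row) (hec : d.col ≤ e.col) :
    ∃ c' : RCCell α, c'.row = c.row ∧ c'.col = e.col ∧ τ.filling e < τ.filling c' := by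
  obtain ⟨t, ht⟩ := Nat.exists_eq_add_of_le hec
  induction t generalizing e with
  | zero =>
    have : e = d := cell_ext her (by omega)
    exact ⟨c, rfl, by omega, this ▸ hlt⟩
  | succ t ih =>
    obtain ⟨e', he'r, he'c⟩ := exists_cell_left e (k := d.col + t) (by omega)
    obtain ⟨c', hc'r, hc'c, hc'⟩ := ih e' (by omega) (by omega) he'c
    have := τ.row_decreasing e' e he'r (by omega)
    obtain ⟨x, hxr, hxc, hx⟩ := τ.triple c' e (by omega) (by omega) (this.trans hc')
    exact ⟨x, by omega, hxc, hx⟩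

/-- An inversion between rows `i < j` moves to the last column of row `j`; a row `k` between them
with `α_k = α_j - 1`, provided by simplicity, then ends just left of that column, and the triple
rule yields an inversion between the rows `i` and `k`. As `α_k < α_j`, this descends to the first
column, which has no inversions. -/
theorem columnsIncrease_of_isSimpleComposition (hα : α.IsSimpleComposition) (τ : SRCT α) :
    τ.ColumnsIncrease := by
  suffices H : ∀ (b : ℕ) (c d : RCCell α), α.blocksFun d.1 = b → c.col = d.col →
      c.row < d.row → ¬ τ.filling d < τ.filling c by
    intro c d hc hr
    refine lt_of_le_of_ne (not_lt.1 (H _ c d rfl hc hr)) fun h => ?_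
    rw [τ.filling.injective h] at hr
    exact lt_irrefl _ hr
  intro b
  induction b using Nat.strong_induction_on with
  | _ b ih =>
    intro c d hb hc hr hlt
    have hdb : d.col < b := hb ▸ d.2.isLt
    let d' : RCCell α := ⟨d.1, ⟨b - 1, by omega⟩⟩
    have hd'r : d'.row = d.row := rfl
    have hd'c : d'.col = b - 1 := rfl
    obtain ⟨c', hc'r, hc'c, hc'⟩ := τ.inversion_right hc hr hlt d' rfl (by omega)
    by_cases hb1 : b = 1
    · exact lt_asymm hc' (τ.col_increasing c' d' (by omega) (by omega) (by omega))
    have hcb : c'.col < α.blocksFun c'.1 := c'.2.isLt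
    obtain ⟨m, hm1, hm2, hm⟩ := hα c'.1 d.1 (show c'.row < d.row by omega) (by omega) (by omega)
    let x : RCCell α := ⟨m, ⟨b - 2, by omega⟩⟩
    have hxr : x.row = m.val := rfl
    have hxc : x.col = b - 2 := rfl
    have hm1' : c'.row < m.val := hm1
    have hm2' : m.val < d.row := hm2
    have hxd : τ.filling x < τ.filling d' := by
      refine lt_of_le_of_ne (not_lt.1 fun h => ?_) fun h => ?_
      · obtain ⟨e, her, hec, -⟩ := τ.triple x d' (by omega) (by omega) h
        have h1 : e.col < α.blocksFun e.1 := e.2.isLt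
        have h2 : e.1 = m := Fin.ext her
        rw [h2] at h1
        omega
      · have := τ.filling.injective h
        rw [this] at hxr
        omega
    obtain ⟨y, hyr, hyc⟩ := exists_cell_left c' (k := b - 2) (by omega)
    have hy := τ.row_decreasing y c' hyr (by omega)
    exact ih (b - 1) (by omega) y x (by change α.blocksFun m = _; omega) (by omega) (by omega)
      (hxd.trans (hc'.trans hy))

/-- If `α` is not simple, witnessed by rows `i < j`, then moving the last cell of row `j` to just
before the cell of row `i` in the same column, in the row-by-row filling order, gives a tableau
with an inversion. -/
theorem exists_not_columnsIncrease (hα : ¬ α.IsSimpleComposition) :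
    ∃ τ : SRCT α, ¬ τ.ColumnsIncrease := by
  unfold Composition.IsSimpleComposition at hα
  push Not at hα
  obtain ⟨i, j, hij, hle, h2, hk⟩ := hα
  have hij' : i.val < j.val := hij
  let q : RCCell α := ⟨j, ⟨α.blocksFun j - 1, by omega⟩⟩
  let p : RCCell α := ⟨i, ⟨α.blocksFun j - 1, by omega⟩⟩
  have hqr : q.row = j.val := rfl
  have hqc : q.col = α.blocksFun j - 1 := rfl
  have hpr : p.row = i.val := rfl
  have hpc : p.col = α.blocksFun j - 1 := rfl
  have hq_max : ∀ c : RCCell α, c.row = q.row → c.col ≤ q.col := by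
    intro c hc
    have h1 : c.col < α.blocksFun c.1 := c.2.isLt
    have h3 : c.1 = j := Fin.ext hc
    rw [h3] at h1
    omega
  -- The column coordinate is doubled to make room for `q` between two cells of row `i`.
  obtain ⟨f, hf⟩ := exists_filling_of_key
    (fun c : RCCell α => if c = q then toLex ((i.val : ℤ), -(2 * q.col + 1 : ℤ))
      else toLex ((c.row : ℤ), -(2 * c.col : ℤ))) (by
      intro c d h
      dsimp only at h
      split_ifs at h with h1 h2 h2
      · rw [h1, h2]
      all_goals simp only [EmbeddingLike.apply_eq_iff_eq, Prod.mk.injEq] at h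
      · omega
      · omega
      · exact cell_ext (by omega) (by omega))
  have hff : ∀ c d, c ≠ q → d ≠ q →
      (f c < f d ↔ (c.row < d.row ∨ c.row = d.row ∧ d.col < c.col)) := by
    intro c d hc hd
    rw [hf, if_neg hc, if_neg hd, Prod.Lex.toLex_lt_toLex]
    dsimp only
    omega
  have hfq : ∀ c, c ≠ q → (f q < f c ↔ (i.val < c.row ∨ i.val = c.row ∧ c.col ≤ q.col)) := by
    intro c hc
    rw [hf, if_neg hc, if_pos rfl, Prod.Lex.toLex_lt_toLex]
    dsimp only
    omega
  have hqf : ∀ c, c ≠ q → (f c < f q ↔ ¬ f q < f c) := by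
    intro c hc
    rw [not_lt]
    exact ⟨le_of_lt, fun h => lt_of_le_of_ne h fun h' => hc (f.injective h')⟩
  refine ⟨⟨f, ?_, ?_, ?_⟩, ?_⟩
  · intro c d hr hc
    have hcq : c ≠ q := by
      rintro rfl
      have := hq_max d hr.symm
      omega
    by_cases hdq : d = q
    · rw [hdq] at hr hc ⊢
      rw [hfq c hcq]; omega
    · rw [hff d c hdq hcq]; omega
  · intro c d hc hd hr
    have hcq : c ≠ q := by rintro rfl; omega
    have hdq : d ≠ q := by rintro rfl; omega
    rw [hff c d hcq hdq]; omega
  · intro c d hr hc hlt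
    have hcq : c ≠ q := by
      rintro rfl
      have hdq : d ≠ q := by rintro rfl; omega
      rw [hqf d hdq, hfq d hdq] at hlt
      omega
    by_cases hdq : d = q
    · subst hdq
      rw [hfq c hcq] at hlt
      have hcb : c.col < α.blocksFun c.1 := c.2.isLt
      -- Row `c.row` lies weakly below `i` and strictly above `j`, so it does not end at `c`.
      have hlong : q.col < α.blocksFun c.1 := by
        by_cases hci : c.1 = i
        · rw [hci]; omega
        · have hci' : c.row ≠ i.val := fun h => hci (Fin.ext h)
          have := hk c.1 (show i.val < c.row by omega) (show c.row < j.val by omega)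
          omega
      let e : RCCell α := ⟨c.1, ⟨q.col, hlong⟩⟩
      have her : e.row = c.row := rfl
      have hec : e.col = q.col := rfl
      have heq : e ≠ q := fun h => by rw [h] at her; omega
      exact ⟨e, her, hec, (hfq e heq).2 (by omega)⟩
    · rw [hff d c hdq hcq] at hlt
      omega
  · intro h
    have hpq : p ≠ q := fun h => by rw [h] at hpr; omega
    have h1 : f p < f q := h p q (by omega) (by omega)
    rw [hqf p hpq, hfq p hpq] at h1
    omega

/-! ### The row-ordered tableau -/

theorem IsRowOrdered.filling_lt_iff {τ : SRCT α} (h : τ.IsRowOrdered) (c d : RCCell α) :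
    τ.filling c < τ.filling d ↔ c.row < d.row ∨ c.row = d.row ∧ d.col < c.col := by
  constructor
  · intro hlt
    by_contra hcon
    by_cases hr : d.row < c.row
    · exact lt_asymm hlt (h d c hr)
    · by_cases hc : c.col = d.col
      · rw [cell_ext (c := c) (d := d) (by omega) hc] at hlt
        exact lt_irrefl _ hlt
      · exact lt_asymm hlt (τ.row_decreasing c d (by omega) (by omega))
  · rintro (hr | ⟨hr, hc⟩)
    · exact h c d hr
    · exact τ.row_decreasing d c hr.symm hc

theorem IsRowOrdered.eq {σ τ : SRCT α} (hσ : σ.IsRowOrdered) (hτ : τ.IsRowOrdered) : σ = τ := by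
  let o : Fin n ≃o Fin n := StrictMono.orderIsoOfSurjective (σ.filling.symm.trans τ.filling)
    (by
      intro a b hab
      simp only [Equiv.trans_apply]
      rw [hτ.filling_lt_iff, ← hσ.filling_lt_iff]
      simpa using hab) (Equiv.surjective _)
  have ho : o = OrderIso.refl _ := Subsingleton.elim _ _
  refine SRCT.ext (Equiv.ext fun c => ?_)
  have := congrArg (fun o : Fin n ≃o Fin n => o (σ.filling c)) ho
  simpa [o] using this.symm

theorem IsRowOrdered.filling_left {σ : SRCT α} (h : σ.IsRowOrdered) {c d : RCCell α}
    (hr : d.row = c.row) (hc : d.col + 1 = c.col) :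
    (σ.filling d).val = (σ.filling c).val + 1 := by
  have h1 : σ.filling c < σ.filling d := σ.row_decreasing d c hr (by omega)
  by_contra hne
  have h1' : (σ.filling c).val < (σ.filling d).val := h1
  have hlt : (σ.filling c).val + 1 < n := by omega
  obtain ⟨x, hx⟩ := σ.filling.surjective ⟨(σ.filling c).val + 1, hlt⟩
  have hx' : (σ.filling x).val = (σ.filling c).val + 1 := congrArg Fin.val hx
  have h2 : σ.filling c < σ.filling x := by rw [Fin.lt_def]; omega
  have h3 : σ.filling x < σ.filling d := by rw [Fin.lt_def]; omega
  rw [h.filling_lt_iff] at h2 h3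
  omega

/-- A tableau with increasing columns is determined by the columns of its entries. -/
theorem ColumnsIncrease.eq_of_colOf_eq {σ τ : SRCT α} (hσ : σ.ColumnsIncrease)
    (hτ : τ.ColumnsIncrease) (h : ∀ k, σ.colOf k = τ.colOf k) : σ = τ := by
  suffices H : ∀ m : ℕ, ∀ k : Fin n, k.val = m → σ.filling.symm k = τ.filling.symm k by
    refine SRCT.ext ?_
    have : σ.filling.symm = τ.filling.symm := Equiv.ext fun k => H _ k rfl
    rw [← Equiv.symm_symm σ.filling, this, Equiv.symm_symm]
  -- If `k` is lower in `σ` than in `τ`, then its cell in `τ` has in `σ` a smaller entry, which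
  -- cannot be at that cell in both tableaux.
  have aux : ∀ {σ τ : SRCT α}, σ.ColumnsIncrease → (∀ k, σ.colOf k = τ.colOf k) →
      ∀ k : Fin n, (∀ k' < k, σ.filling.symm k' = τ.filling.symm k') →
      ¬ (τ.filling.symm k).row < (σ.filling.symm k).row := by
    intro σ τ hσ h k ih hlt
    have h1 := hσ _ _ (h k).symm hlt
    rw [Equiv.apply_symm_apply] at h1
    have h2 := ih _ h1
    rw [Equiv.symm_apply_apply] at h2
    have h3 := τ.filling.symm.injective h2
    rw [← h3] at h1
    exact lt_irrefl _ h1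
  intro m
  induction m using Nat.strong_induction_on with
  | _ m ih =>
    intro k hk
    have ih' : ∀ k' < k, σ.filling.symm k' = τ.filling.symm k' := fun k' hk' =>
      ih k' (hk ▸ hk') k' rfl
    have h1 := aux hσ h k ih'
    have h2 := aux hτ (fun k => (h k).symm) k (fun k' hk' => (ih' k' hk').symm)
    exact cell_ext (by omega) (h k)

/-- Among the tableaux with increasing columns, only the row-ordered one has its descents among
those of the row-ordered tableau `σ`. Indeed each entry of such a `τ` is weakly to the right of
its position in `σ`, and the columns of all entries have the same sum in `σ` and `τ`. -/
theorem ColumnsIncrease.eq_of_isDescent {σ τ : SRCT α} (hσ : σ.IsRowOrdered)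
    (hτ : τ.ColumnsIncrease) (h : ∀ i, τ.IsDescent i → σ.IsDescent i) : τ = σ := by
  have hle : ∀ (m : ℕ) (k : Fin n), n - k.val = m → σ.colOf k ≤ τ.colOf k := by
    intro m
    induction m with
    | zero => intro k hk; omega
    | succ m ih =>
      intro k hk
      by_cases h0 : σ.colOf k = 0
      · omega
      have hcol : (σ.filling.symm k).col = σ.colOf k := rfl
      obtain ⟨d, hdr, hdc⟩ := exists_cell_left (σ.filling.symm k) (k := σ.colOf k - 1) (by omega)
      have hd := hσ.filling_left hdr (by omega)
      rw [Equiv.apply_symm_apply] at hd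
      have hkn : k.val < n - 1 := by omega
      have hlo : entryLo ⟨k.val, hkn⟩ = k := rfl
      have hhi : entryHi ⟨k.val, hkn⟩ = σ.filling d := Fin.ext hd.symm
      have hdc' : σ.colOf (σ.filling d) = d.col := by simp [colOf]
      have hnd := mt (h ⟨k.val, hkn⟩)
      unfold IsDescent at hnd
      rw [hlo, hhi] at hnd
      have := ih (σ.filling d) (by omega)
      omega
  have hsum : ∀ τ : SRCT α, ∑ k, τ.colOf k = ∑ c : RCCell α, c.col := fun τ =>
    Equiv.sum_comp τ.filling.symm RCCell.col
  have heq := (Finset.sum_eq_sum_iff_of_le fun k _ => hle _ k rfl).1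
    ((hsum σ).trans (hsum τ).symm)
  exact hτ.eq_of_colOf_eq hσ.columnsIncrease fun k => (heq k (Finset.mem_univ k)).symm

/-! ### Reaching every tableau from the row-ordered one -/

theorem colOf_of_not_isDescent (τ : SRCT α) {i : Fin (n - 1)} (hd : ¬ τ.IsDescent i)
    (hr : τ.rowOf (entryLo i) = τ.rowOf (entryHi i)) :
    τ.colOf (entryHi i) + 1 = τ.colOf (entryLo i) := by
  unfold IsDescent at hd
  by_contra hne
  obtain ⟨e, her, hec⟩ := exists_cell_left (τ.filling.symm (entryLo i))
    (k := τ.colOf (entryLo i) - 1) (Nat.sub_le _ _)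
  change e.row = τ.rowOf (entryLo i) at her
  have h1 := τ.row_decreasing e (τ.filling.symm (entryLo i)) her
    (by change e.col < τ.colOf (entryLo i); omega)
  have h2 := τ.row_decreasing (τ.filling.symm (entryHi i)) e
    (by change τ.rowOf (entryHi i) = _; omega) (by change τ.colOf (entryHi i) < _; omega)
  rw [Equiv.apply_symm_apply] at h1 h2
  simp only [entryLo, entryHi, Fin.lt_def] at h1 h2
  omega

/-- If every non-descent of a tableau with increasing columns has its two entries in one row, then
every entry outside the first column is followed by the entry to its left. For an entry `e` that
is the last exception, `e + 1` starts a run of consecutive entries going left to the first column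
in a lower row. By the increasing columns the entry to the left of `e` is at most the entry of the
run below it, so it would itself belong to the run. -/
theorem ColumnsIncrease.filling_left {τ : SRCT α} (hτ : τ.ColumnsIncrease)
    (hsrc : ∀ i, ¬ τ.IsDescent i → τ.rowOf (entryLo i) = τ.rowOf (entryHi i)) (c : RCCell α)
    (hc : 0 < c.col) :
    ∃ d : RCCell α, d.row = c.row ∧ d.col + 1 = c.col ∧
      (τ.filling d).val = (τ.filling c).val + 1 := by
  obtain ⟨m, hm⟩ : ∃ m, n - (τ.filling c).val = m := ⟨_, rfl⟩
  induction m using Nat.strong_induction_on generalizing c with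
  | _ m ih =>
    obtain ⟨l, hlr, hlc⟩ := exists_cell_left c (k := c.col - 1) (by omega)
    have hl : (τ.filling c).val < (τ.filling l).val := τ.row_decreasing l c hlr (by omega)
    have hen : (τ.filling c).val < n - 1 := by omega
    obtain ⟨i, hi⟩ : ∃ i : Fin (n - 1), i.val = (τ.filling c).val := ⟨⟨_, hen⟩, rfl⟩
    obtain ⟨h, hh⟩ := τ.filling.surjective (entryHi i)
    have hlo : τ.filling c = entryLo i := Fin.ext hi.symm
    have hval : (τ.filling h).val = (τ.filling c).val + 1 := by
      rw [hh, ← hi]; rfl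
    have hcc : τ.colOf (entryLo i) = c.col := by rw [← hlo]; simp [colOf]
    have hcr : τ.rowOf (entryLo i) = c.row := by rw [← hlo]; simp [rowOf]
    have hhc : τ.colOf (entryHi i) = h.col := by rw [← hh]; simp [colOf]
    have hhr : τ.rowOf (entryHi i) = h.row := by rw [← hh]; simp [rowOf]
    by_cases hd : τ.IsDescent i
    swap
    · have h1 := hsrc i hd
      have h2 := τ.colOf_of_not_isDescent hd h1
      exact ⟨h, by omega, by omega, hval⟩
    exfalso
    have hd' : c.col ≤ h.col := by
      unfold IsDescent at hd; omega
    have run : ∀ t ≤ h.col, ∃ x : RCCell α, x.row = h.row ∧ x.col + t = h.col ∧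
        (τ.filling x).val = (τ.filling c).val + 1 + t := by
      intro t
      induction t with
      | zero => intro _; exact ⟨h, rfl, rfl, hval⟩
      | succ t iht =>
        intro ht
        obtain ⟨x, hxr, hxc, hx⟩ := iht (by omega)
        obtain ⟨d, hdr, hdc, hd⟩ := ih _ (by omega) x (by omega) rfl
        exact ⟨d, by omega, by omega, by omega⟩
    have hne : h.row ≠ c.row := by
      intro hr
      by_cases hcol : c.col = h.col
      · rw [cell_ext hr hcol.symm] at hval
        omega
      · have : (τ.filling h).val < (τ.filling c).val :=
          τ.row_decreasing c h hr.symm (by omega)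
        omega
    obtain ⟨x, hxr, hxc, hx⟩ := run (h.col - c.col) (by omega)
    obtain ⟨y, hyr, hyc, hy⟩ := run (h.col - c.col + 1) (by omega)
    have hrow : c.row < h.row := by
      by_contra hcon
      have : (τ.filling x).val < (τ.filling c).val := hτ x c (by omega) (by omega)
      omega
    have hly : (τ.filling l).val < (τ.filling y).val := hτ l y (by omega) (by omega)
    obtain ⟨z, hzr, -, hz⟩ := run ((τ.filling l).val - ((τ.filling c).val + 1)) (by omega)
    have hzl : z = l := τ.filling.injective (Fin.ext (by omega))
    rw [hzl] at hzr
    omega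

theorem ColumnsIncrease.isRowOrdered {τ : SRCT α} (hτ : τ.ColumnsIncrease)
    (hsrc : ∀ i, ¬ τ.IsDescent i → τ.rowOf (entryLo i) = τ.rowOf (entryHi i)) :
    τ.IsRowOrdered := by
  have step : ∀ c h : RCCell α, (τ.filling h).val = (τ.filling c).val + 1 → c.row ≤ h.row := by
    intro c h hch
    by_cases hc : c.col = 0
    · by_contra hcon
      obtain ⟨z, hzr, hzc⟩ := exists_cell_left h (k := 0) (Nat.zero_le _)
      have h1 : (τ.filling z).val < (τ.filling c).val :=
        τ.col_increasing z c hzc hc (by omega)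
      by_cases hh : h.col = 0
      · rw [cell_ext hzr (hzc.trans hh.symm)] at h1
        omega
      · have h2 : (τ.filling h).val < (τ.filling z).val :=
          τ.row_decreasing z h hzr (by omega)
        omega
    · obtain ⟨d, hdr, -, hd⟩ := hτ.filling_left hsrc c (by omega)
      have : d = h := τ.filling.injective (Fin.ext (by omega))
      rw [← this]
      exact hdr.ge
  have mono : ∀ (t : ℕ) (c d : RCCell α), (τ.filling d).val = (τ.filling c).val + t →
      c.row ≤ d.row := by
    intro t
    induction t with
    | zero =>
      intro c d h
      rw [τ.filling.injective (Fin.ext h)]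
    | succ t ih =>
      intro c d h
      obtain ⟨x, hx⟩ := τ.filling.surjective ⟨(τ.filling c).val + t, by omega⟩
      have hx' : (τ.filling x).val = (τ.filling c).val + t := congrArg Fin.val hx
      exact (ih c x hx').trans (step x d (by omega))
  intro c d hr
  by_contra hcon
  have hcon' : (τ.filling d).val ≤ (τ.filling c).val := not_lt.1 hcon
  obtain ⟨t, ht⟩ := Nat.exists_eq_add_of_le hcon'
  have := mono t d c ht
  omega

/-- If `i` is not a descent of `τ` and `i`, `i + 1` are in different rows, then `τ` is the image
under `π_i` of the tableau with `i` and `i + 1` exchanged. -/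
theorem exists_piOp_eq (τ : SRCT α) (i : Fin (n - 1)) (hd : ¬ τ.IsDescent i)
    (hr : τ.rowOf (entryLo i) ≠ τ.rowOf (entryHi i)) :
    ∃ τ' : SRCT α, (∀ k, τ'.colOf k = τ.colOf (Equiv.swap (entryLo i) (entryHi i) k)) ∧
      piOp α i (Finsupp.single τ' 1) = Finsupp.single τ 1 := by
  have hd' := hd
  unfold IsDescent at hd'
  have hcol : ∀ {c k}, τ.filling c = k → τ.colOf k = c.col := by
    rintro c k rfl; simp [colOf]
  have hrow : ∀ {c k}, τ.filling c = k → τ.rowOf k = c.row := by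
    rintro c k rfl; simp [rowOf]
  let τ' : SRCT α :=
    { filling := τ.filling.trans (Equiv.swap (entryLo i) (entryHi i))
      row_decreasing := by
        intro c d h1 h2
        refine swap_lt_swap ?_ (τ.row_decreasing c d h1 h2)
        rintro ⟨h3, h4⟩
        exact hr (by rw [hrow h3, hrow h4, h1])
      col_increasing := by
        intro c d h1 h2 h3
        refine swap_lt_swap ?_ (τ.col_increasing c d h1 h2 h3)
        rintro ⟨h4, h5⟩
        rw [hcol h4, hcol h5] at hd'
        omega
      triple := by
        intro c d h1 h2 hlt
        have h : τ.filling d < τ.filling c := by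
          refine lt_of_swap_lt_swap ?_ hlt
          rintro ⟨h3, h4⟩
          rw [hcol h3, hcol h4] at hd'
          omega
        obtain ⟨e, her, hec, he⟩ := τ.triple c d h1 h2 h
        refine ⟨e, her, hec, swap_lt_swap ?_ he⟩
        rintro ⟨h3, h4⟩
        rw [hcol h3, hcol h4] at hd'
        omega }
  have hc' : ∀ k, τ'.colOf k = τ.colOf (Equiv.swap (entryLo i) (entryHi i) k) := by
    intro k; simp [τ', colOf]
  have hr' : ∀ k, τ'.rowOf k = τ.rowOf (Equiv.swap (entryLo i) (entryHi i) k) := by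
    intro k; simp [τ', rowOf]
  refine ⟨τ', hc', ?_⟩
  rcases τ'.piOp_cases i with ⟨h, -⟩ | ⟨-, h, -⟩ | ⟨-, -, σ, h, hf, -⟩
  · simp only [IsDescent, hc', Equiv.swap_apply_left, Equiv.swap_apply_right] at h
    omega
  · simp only [IsAttacking, hc', hr', Equiv.swap_apply_left, Equiv.swap_apply_right] at h
    rcases h with h | ⟨h1, h2⟩
    · omega
    exfalso
    -- The triple rule would demand an entry strictly between `i` and `i + 1`.
    obtain ⟨c, hc⟩ := τ.filling.surjective (entryHi i)
    obtain ⟨d, hd⟩ := τ.filling.surjective (entryLo i)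
    rw [hcol hc, hcol hd] at h1
    rw [hrow hc, hrow hd] at h2
    obtain ⟨e, her, hec, he⟩ := τ.triple c d h2 h1 (by rw [hc, hd]; exact entryLo_lt i)
    have h3 := τ.row_decreasing c e her.symm (by omega)
    rw [hd] at he
    rw [hc] at h3
    simp only [entryLo, entryHi, Fin.lt_def] at he h3
    omega
  · rw [h]
    congr 1
    refine SRCT.ext (Equiv.ext fun c => ?_)
    rw [hf]
    simp [τ']

/-- If all tableaux of shape `α` have increasing columns, the row-ordered one generates `S_α`:
exchanging `i` and `i + 1` as in `exists_piOp_eq` increases `∑ k, k * colOf k`, and ends only at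
the row-ordered tableau. -/
theorem single_mem_of_isRowOrdered (hα : ∀ τ : SRCT α, τ.ColumnsIncrease) {σ : SRCT α}
    (hσ : σ.IsRowOrdered) (N : Set (SRCT α →₀ ℂ)) (hN : ∀ i, ∀ v ∈ N, piOp α i v ∈ N)
    (hσN : Finsupp.single σ 1 ∈ N) (τ : SRCT α) : Finsupp.single τ 1 ∈ N := by
  classical
  by_contra hτ
  let w : SRCT α → ℕ := fun τ => ∑ k : Fin n, k.val * τ.colOf k
  obtain ⟨τ, hτN, hmax⟩ := Set.exists_max_image {τ : SRCT α | Finsupp.single τ 1 ∉ N} w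
    (Set.toFinite _) ⟨τ, hτ⟩
  by_cases hsrc : ∀ i, ¬ τ.IsDescent i → τ.rowOf (entryLo i) = τ.rowOf (entryHi i)
  · rw [((hα τ).isRowOrdered hsrc).eq hσ] at hτN
    exact hτN hσN
  push Not at hsrc
  obtain ⟨i, hd, hr⟩ := hsrc
  obtain ⟨τ', hc, hpi⟩ := τ.exists_piOp_eq i hd hr
  have hτ' : τ' ∈ {τ : SRCT α | Finsupp.single τ 1 ∉ N} := fun h =>
    hτN (hpi ▸ hN i _ h)
  have hw := hmax τ' hτ'
  have hlt : w τ < w τ' := by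
    have hne := (entryLo_lt i).ne
    have e1 : ∀ τ : SRCT α, w τ = ((entryLo i).val * τ.colOf (entryLo i) +
        (entryHi i).val * τ.colOf (entryHi i)) +
        ∑ k ∈ {entryLo i, entryHi i}ᶜ, k.val * τ.colOf k := by
      intro τ
      rw [← Finset.sum_pair (f := fun k : Fin n => k.val * τ.colOf k) hne,
        Finset.sum_add_sum_compl]
    have e2 : ∑ k ∈ {entryLo i, entryHi i}ᶜ, k.val * τ'.colOf k =
        ∑ k ∈ {entryLo i, entryHi i}ᶜ, k.val * τ.colOf k := by
      refine Finset.sum_congr rfl fun k hk => ?_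
      simp only [Finset.mem_compl, Finset.mem_insert, Finset.mem_singleton, not_or] at hk
      rw [hc, Equiv.swap_apply_of_ne_of_ne hk.1 hk.2]
    rw [e1, e1, e2, hc, hc, Equiv.swap_apply_left, Equiv.swap_apply_right]
    unfold IsDescent at hd
    have h3 : (entryHi i).val = (entryLo i).val + 1 := rfl
    rw [h3]
    have : (entryLo i).val * τ.colOf (entryHi i) + (entryLo i).val * τ.colOf (entryLo i) =
      (entryLo i).val * τ.colOf (entryLo i) + (entryLo i).val * τ.colOf (entryHi i) := add_comm _ _
    rw [add_mul, add_mul]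
    omega
  omega

/-! ### Vectors fixed by the operators fixing the row-ordered tableau -/

/-- The image of `π_i` involves no tableau having `i` as a descent. -/
theorem piOp_apply_of_isDescent (i : Fin (n - 1)) (v : SRCT α →₀ ℂ) {τ : SRCT α}
    (hτ : τ.IsDescent i) : piOp α i v τ = 0 := by
  induction v using Finsupp.induction_linear with
  | zero => simp
  | add v w hv hw => rw [map_add, Finsupp.add_apply, hv, hw, add_zero]
  | single σ a =>
    have ha : Finsupp.single σ a = a • Finsupp.single σ (1 : ℂ) := by simp
    rw [ha, map_smul, Finsupp.smul_apply]
    suffices h : piOp α i (Finsupp.single σ 1) τ = 0 by rw [h, smul_zero]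
    rcases σ.piOp_cases i with ⟨hd, h⟩ | ⟨-, -, h⟩ | ⟨hd, ha, σ', h, -, hc, -⟩
    · rw [h, Finsupp.single_eq_of_ne]
      rintro rfl
      exact hd hτ
    · simp [h]
    · rw [h, Finsupp.single_eq_of_ne]
      rintro rfl
      simp only [IsDescent, IsAttacking, hc, Equiv.swap_apply_left, Equiv.swap_apply_right]
        at hd ha hτ
      omega

/-- If all tableaux of shape `α` have increasing columns, a vector fixed by every `π_i` fixing the
row-ordered tableau is a multiple of that tableau. -/
theorem eq_smul_single_of_piOp_eq (hα : ∀ τ : SRCT α, τ.ColumnsIncrease) {σ : SRCT α}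
    (hσ : σ.IsRowOrdered) (v : SRCT α →₀ ℂ) (hv : ∀ i, ¬ σ.IsDescent i → piOp α i v = v) :
    v = v σ • Finsupp.single σ 1 := by
  ext τ
  by_cases hτ : τ = σ
  · subst hτ; simp
  · have h0 : v τ = 0 := by
      by_contra h0
      refine hτ ((hα τ).eq_of_isDescent hσ fun i hi => ?_)
      by_contra hd
      rw [← hv i hd, piOp_apply_of_isDescent i v hi] at h0
      exact h0 rfl
    rw [h0, Finsupp.smul_apply, Finsupp.single_eq_of_ne hτ, smul_zero]

/-! ### Submodules of `S_α` -/

theorem columnsIncrease_exchange_iff (τ : SRCT α) (i : Fin (n - 1)) (hd : τ.IsDescent i)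
    (ha : ¬ τ.IsAttacking i) : (τ.exchange i hd ha).ColumnsIncrease ↔ τ.ColumnsIncrease := by
  have key : ∀ {c d : RCCell α} {x y : Fin n}, c.col = d.col → τ.filling c = x →
      τ.filling d = y → τ.colOf x = τ.colOf y := by
    rintro c d x y h rfl rfl
    simpa [colOf] using h
  have hne : τ.colOf (entryLo i) ≠ τ.colOf (entryHi i) := fun h => ha (Or.inl h)
  constructor
  · intro h c d hc hr
    refine lt_of_swap_lt_swap ?_ (h c d hc hr)
    rintro ⟨h1, h2⟩
    exact hne (key hc h1 h2).symm
  · intro h c d hc hr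
    refine swap_lt_swap ?_ (h c d hc hr)
    rintro ⟨h1, h2⟩
    exact hne (key hc h1 h2)

end SRCT

/-- The identification of the space of combinations of tableaux with its type synonym `S_α`. -/
noncomputable def SModule.of {n : ℕ} (α : Composition n) : (SRCT α →₀ ℂ) ≃+ SModule α :=
  AddEquiv.refl (SRCT α →₀ ℂ)

theorem ZeroHecke.smul_of {n : ℕ} {α : Composition n} (h : ZeroHecke n) (v : SRCT α →₀ ℂ) :
    h • SModule.of α v = SModule.of α (zeroHeckeAction α h v) :=
  rfl

/-- The linear subspace underlying a submodule of `S_α`. -/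
def SModule.subspace {n : ℕ} {α : Composition n} (N : Submodule (ZeroHecke n) (SModule α)) :
    Submodule ℂ (SRCT α →₀ ℂ) where
  carrier := {v | SModule.of α v ∈ N}
  add_mem' hv hw := by
    rw [Set.mem_ofPred_eq, map_add]
    exact N.add_mem hv hw
  zero_mem' := by
    rw [Set.mem_ofPred_eq, map_zero]
    exact N.zero_mem
  smul_mem' a v hv := by
    have := N.smul_mem (algebraMap ℂ (ZeroHecke n) a) (show SModule.of α v ∈ N from hv)
    rwa [ZeroHecke.smul_of, AlgHom.commutes] at this

theorem SModule.mem_subspace {n : ℕ} {α : Composition n}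
    {N : Submodule (ZeroHecke n) (SModule α)} {v : SRCT α →₀ ℂ} :
    v ∈ SModule.subspace N ↔ SModule.of α v ∈ N :=
  Iff.rfl

theorem SModule.piOp_mem_subspace {n : ℕ} {α : Composition n}
    (N : Submodule (ZeroHecke n) (SModule α)) (i : Fin (n - 1)) (v : SRCT α →₀ ℂ)
    (hv : v ∈ SModule.subspace N) : SRCT.piOp α i v ∈ SModule.subspace N := by
  have := N.smul_mem (ZeroHecke.T i) (SModule.mem_subspace.1 hv)
  rwa [ZeroHecke.smul_of, zeroHeckeAction_T] at this

theorem SModule.subspace_injective {n : ℕ} {α : Composition n} :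
    Function.Injective (SModule.subspace (α := α)) := by
  intro N P h
  ext v
  obtain ⟨v, rfl⟩ := (SModule.of α).surjective v
  rw [← SModule.mem_subspace, h, SModule.mem_subspace]

theorem SModule.subspace_bot {n : ℕ} {α : Composition n} :
    SModule.subspace (⊥ : Submodule (ZeroHecke n) (SModule α)) = ⊥ := by
  ext v
  simp [SModule.mem_subspace]

theorem SModule.isCompl_subspace_iff {n : ℕ} {α : Composition n}
    {N P : Submodule (ZeroHecke n) (SModule α)} :
    IsCompl (SModule.subspace N) (SModule.subspace P) ↔ IsCompl N P := by
  rw [isCompl_iff, isCompl_iff, Submodule.disjoint_def, Submodule.disjoint_def,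
    Submodule.codisjoint_iff_exists_add_eq, Submodule.codisjoint_iff_exists_add_eq]
  simp only [(SModule.of α).surjective.forall, (SModule.of α).surjective.exists,
    SModule.mem_subspace, ← map_add, (SModule.of α).injective.eq_iff,
    EmbeddingLike.map_eq_zero_iff]

/-- A linear subspace of `S_α` stable under all the operators `π_i` underlies a submodule. -/
theorem SModule.exists_subspace_eq {n : ℕ} {α : Composition n}
    (W : Submodule ℂ (SRCT α →₀ ℂ)) (hW : ∀ i, ∀ v ∈ W, SRCT.piOp α i v ∈ W) :
    ∃ N : Submodule (ZeroHecke n) (SModule α), SModule.subspace N = W := by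
  have hact : ∀ h : ZeroHecke n, ∀ v ∈ W, zeroHeckeAction α h v ∈ W := by
    intro h
    let S : Subalgebra ℂ (Module.End ℂ (SRCT α →₀ ℂ)) :=
      { carrier := {f | ∀ v ∈ W, f v ∈ W}
        mul_mem' := fun hf hg v hv => hf _ (hg v hv)
        add_mem' := fun hf hg v hv => W.add_mem (hf v hv) (hg v hv)
        algebraMap_mem' := fun a v hv => W.smul_mem a hv }
    suffices H : zeroHeckeAction α h ∈ S from H
    obtain ⟨x, rfl⟩ := RingQuot.mkAlgHom_surjective ℂ (ZeroHeckeRel n) h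
    have hx : zeroHeckeAction α (RingQuot.mkAlgHom ℂ (ZeroHeckeRel n) x) =
        FreeAlgebra.lift ℂ (SRCT.piOp α) x :=
      RingQuot.liftAlgHom_mkAlgHom_apply ℂ _ _ _
    rw [hx]
    induction x using FreeAlgebra.induction with
    | grade0 a => rw [AlgHom.commutes]; exact S.algebraMap_mem a
    | grade1 i => rw [FreeAlgebra.lift_ι_apply]; exact hW i
    | mul x y ihx ihy =>
      rw [map_mul]
      exact S.mul_mem (ihx (RingQuot.liftAlgHom_mkAlgHom_apply ℂ _ _ _))
        (ihy (RingQuot.liftAlgHom_mkAlgHom_apply ℂ _ _ _))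
    | add x y ihx ihy =>
      rw [map_add]
      exact S.add_mem (ihx (RingQuot.liftAlgHom_mkAlgHom_apply ℂ _ _ _))
        (ihy (RingQuot.liftAlgHom_mkAlgHom_apply ℂ _ _ _))
  refine ⟨{ carrier := {v | (SModule.of α).symm v ∈ W}
            add_mem' := fun hv hw => by
              rw [Set.mem_ofPred_eq, map_add]
              exact W.add_mem hv hw
            zero_mem' := by
              rw [Set.mem_ofPred_eq, map_zero]
              exact W.zero_mem
            smul_mem' := fun h v hv => hact h _ hv }, ?_⟩
  ext v
  change (SModule.of α).symm (SModule.of α v) ∈ W ↔ v ∈ W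
  rw [AddEquiv.symm_apply_apply]

/-! ### Decomposability and indecomposability -/

theorem SRCT.piOp_mem_supported {n : ℕ} {α : Composition n} (A : Set (SRCT α))
    (hA : ∀ τ ∈ A, ∀ i hd ha, τ.exchange i hd ha ∈ A) (i : Fin (n - 1)) (v : SRCT α →₀ ℂ)
    (hv : v ∈ Finsupp.supported ℂ ℂ A) : SRCT.piOp α i v ∈ Finsupp.supported ℂ ℂ A := by
  rw [SRCT.piOp, Finsupp.linearCombination_apply]
  refine Submodule.sum_mem _ fun τ hτ => Submodule.smul_mem _ _ ?_
  have hτA : τ ∈ A := (Finsupp.mem_supported ℂ v).1 hv hτ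
  unfold SRCT.piOn
  split_ifs with hd ha
  · exact Submodule.zero_mem _
  · exact Finsupp.single_mem_supported ℂ 1 (hA τ hτA i hd ha)
  · exact Finsupp.single_mem_supported ℂ 1 hτA

/-- A set of tableaux such that it and its complement are stable under the exchanges splits
`S_α`. -/
theorem SModule.not_isIndecomposableModule {n : ℕ} {α : Composition n} (A : Set (SRCT α))
    (hA : ∀ τ i hd ha, SRCT.exchange τ i hd ha ∈ A ↔ τ ∈ A) {σ τ : SRCT α} (hσ : σ ∈ A)
    (hτ : τ ∉ A) : ¬ IsIndecomposableModule (ZeroHecke n) (SModule α) := by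
  rintro ⟨-, h⟩
  obtain ⟨N, hN⟩ := SModule.exists_subspace_eq (Finsupp.supported ℂ ℂ A)
    (SRCT.piOp_mem_supported A fun τ hτ i hd ha => (hA τ i hd ha).2 hτ)
  obtain ⟨P, hP⟩ := SModule.exists_subspace_eq (Finsupp.supported ℂ ℂ Aᶜ)
    (SRCT.piOp_mem_supported Aᶜ fun τ hτ i hd ha h => hτ ((hA τ i hd ha).1 h))
  have hNP : IsCompl N P := by
    rw [← SModule.isCompl_subspace_iff, hN, hP]
    exact ⟨Finsupp.disjoint_supported_supported disjoint_compl_right,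
      Finsupp.codisjoint_supported_supported isCompl_compl.codisjoint⟩
  have hne : ∀ τ : SRCT α, Finsupp.single τ (1 : ℂ) ≠ 0 := fun τ => by simp
  rcases h N P hNP with rfl | rfl
  · rw [SModule.subspace_bot] at hN
    have := Finsupp.single_mem_supported ℂ (1 : ℂ) hσ
    rw [← hN] at this
    exact hne σ ((Submodule.mem_bot _).1 this)
  · rw [SModule.subspace_bot] at hP
    have := Finsupp.single_mem_supported ℂ (1 : ℂ) (s := Aᶜ) hτ
    rw [← hP] at this
    exact hne τ ((Submodule.mem_bot _).1 this)

/-- If all tableaux of shape `α` have increasing columns, a subspace of `S_α` stable under the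
operators `π_i` and containing a nonzero multiple of the row-ordered tableau is everything. -/
theorem SRCT.eq_top_of_smul_single_mem {n : ℕ} {α : Composition n}
    (hα : ∀ τ : SRCT α, τ.ColumnsIncrease) {σ : SRCT α} (hσ : σ.IsRowOrdered)
    (W : Submodule ℂ (SRCT α →₀ ℂ)) (hW : ∀ i, ∀ v ∈ W, SRCT.piOp α i v ∈ W) {a : ℂ}
    (ha : a ≠ 0) (haW : a • Finsupp.single σ 1 ∈ W) : W = ⊤ := by
  have hall := SRCT.single_mem_of_isRowOrdered hα hσ W hW ((W.smul_mem_iff ha).1 haW)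
  refine (Submodule.eq_top_iff').2 fun v => ?_
  induction v using Finsupp.induction_linear with
  | zero => exact W.zero_mem
  | add v w hv hw => exact W.add_mem hv hw
  | single τ b =>
    have := W.smul_mem b (hall τ)
    rwa [Finsupp.smul_single, smul_eq_mul, mul_one] at this

/-- Both components of the row-ordered tableau along a direct sum decomposition are multiples of
it, so it lies in one of the summands, which it generates. -/
theorem SModule.isIndecomposableModule {n : ℕ} {α : Composition n}
    (hα : ∀ τ : SRCT α, τ.ColumnsIncrease) :
    IsIndecomposableModule (ZeroHecke n) (SModule α) := by
  obtain ⟨σ, hσ⟩ := SRCT.exists_isRowOrdered α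
  have : Nonempty (SRCT α) := ⟨σ⟩
  refine ⟨(SModule.of α).symm.toEquiv.nontrivial, fun N P hNP => ?_⟩
  have hN := SModule.piOp_mem_subspace N
  have hP := SModule.piOp_mem_subspace P
  rw [← SModule.isCompl_subspace_iff] at hNP
  rw [← SModule.subspace_injective.eq_iff (a := N), ← SModule.subspace_injective.eq_iff (a := P),
    SModule.subspace_bot]
  generalize SModule.subspace N = V at *
  generalize SModule.subspace P = W at *
  obtain ⟨x, y, hx, hy, hxy⟩ := Submodule.codisjoint_iff_exists_add_eq.1 hNP.codisjoint
    (Finsupp.single σ 1)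
  have hfix : ∀ i, ¬ σ.IsDescent i → SRCT.piOp α i x = x ∧ SRCT.piOp α i y = y := by
    intro i hd
    have h1 : SRCT.piOp α i (Finsupp.single σ 1) = Finsupp.single σ 1 := by
      rcases σ.piOp_cases i with ⟨-, h⟩ | ⟨h, -⟩ | ⟨h, -⟩
      · exact h
      all_goals exact absurd h hd
    rw [← hxy, map_add] at h1
    have h3 : SRCT.piOp α i x - x = y - SRCT.piOp α i y := by
      rw [sub_eq_sub_iff_add_eq_add, h1, add_comm]
    have h4 : SRCT.piOp α i x - x = 0 :=
      Submodule.disjoint_def.1 hNP.disjoint _ (V.sub_mem (hN i x hx) hx)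
        (h3 ▸ W.sub_mem hy (hP i y hy))
    exact ⟨sub_eq_zero.1 h4, (sub_eq_zero.1 (h3 ▸ h4)).symm⟩
  have ex := SRCT.eq_smul_single_of_piOp_eq hα hσ x fun i hi => (hfix i hi).1
  have ey := SRCT.eq_smul_single_of_piOp_eq hα hσ y fun i hi => (hfix i hi).2
  have hsum : x σ + y σ = 1 := by
    rw [← Finsupp.add_apply, hxy, Finsupp.single_eq_same]
  by_cases hx0 : x σ = 0
  · left
    have hy0 : y σ ≠ 0 := by
      rw [hx0, zero_add] at hsum
      rw [hsum]
      exact one_ne_zero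
    rw [SRCT.eq_top_of_smul_single_mem hα hσ W hP hy0 (ey ▸ hy)] at hNP
    exact eq_bot_of_isCompl_top hNP
  · right
    rw [SRCT.eq_top_of_smul_single_mem hα hσ V hN hx0 (ex ▸ hx)] at hNP
    exact eq_bot_of_top_isCompl hNP

theorem theorem7p6 (n : ℕ) (α : Composition n) :
    IsIndecomposableModule (ZeroHecke n) (SModule α) ↔ α.IsSimpleComposition := by
  refine ⟨fun h => ?_, fun h => SModule.isIndecomposableModule
    (SRCT.columnsIncrease_of_isSimpleComposition h)⟩
  by_contra hα
  obtain ⟨τ, hτ⟩ := SRCT.exists_not_columnsIncrease hα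
  obtain ⟨σ, hσ⟩ := SRCT.exists_isRowOrdered α
  exact SModule.not_isIndecomposableModule {τ | τ.ColumnsIncrease}
    (fun τ i hd ha => τ.columnsIncrease_exchange_iff i hd ha) hσ.columnsIncrease hτ h
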